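/- Let $T$ be an arbitrary set. Consider real-valued stochastic processes $X=\{X_t\}_{t\in T}$ with identical one-dimensional margins, and let $\tau_{\mathrm{up}}\in(-\infty,\infty]$ be the upper endpoint (essential supremum) of the margins. If the limit $$\chi^{(X)}(s,t)=\lim_{\tau\uparrow\tau_{\mathrm{up}}}\mathbb P(X_s>\tau\mid X_t>\tau)$$ exists for all $s,t\in T$, then $\chi^{(X)}:T\times T\to\mathbb R$ is called the tail correlation function (TCF) of $X$, and $X$ is said to realize it. Let $\mathrm{TCF}(T)\subset\mathbb R^{T\times T}$ be the set of all functions that are the TCF of some such process. Then: (a) $\mathrm{TCF}(T)$ is convex. (b) $\mathrm{TCF}(T)$ is closed under pointwise multiplication. More precisely, any $\chi_1,\chi_2\in\mathrm{TCF}(T)$ are realized by processes $X^{(1)},X^{(2)}$ with upper endpoint $\infty$ that are defined on a common probability space and independent of each other; and whenever $X^{(1)},X^{(2)}$ are independent processes with upper endpoint $\infty$ realizing $\chi_1,\chi_2$, the process $\{X^{(1)}_t\wedge X^{(2)}_t\}_{t\in T}$ has identical one-dimensional margins, upper endpoint $\infty$ and TCF $\chi_1\cdot\chi_2$. (c) $\mathrm{TCF}(T)$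 is compact with respect to the topology of pointwise convergence on $\mathbb R^{T\times T}$. -/

import Mathlib

open MeasureTheory ProbabilityTheory Filter Topology

universe u v

/-- The upper endpoint of (the distribution of) a real random variable `Y`, i.e. its essential
supremum, as an extended real number. -/
noncomputable def upperEndpoint {Ω : Type v} [MeasurableSpace Ω] (P : Measure Ω) (Y : Ω → ℝ) :
    EReal :=
  essSup (fun ω => (Y ω : EReal)) P

/-- The filter of real thresholds `τ` tending to `b` with `τ < b`, where `b` may be `∞`. -/
noncomputable def thresholdsTo (b : EReal) : Filter ℝ :=
  comap ((↑) : ℝ → EReal) (𝓝[<] b)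

/-- The family `X` of random variables on `(Ω, P)` is a real-valued stochastic process on `T` with
identical one-dimensional margins of upper endpoint `b`, whose tail correlation function
`lim_{τ → b} P(X s > τ | X t > τ)` exists for all `s t` and is equal to `χ (s, t)`. -/
structure HasTCF {T : Type u} {Ω : Type v} [MeasurableSpace Ω] (P : Measure Ω) (X : T → Ω → ℝ)
    (b : EReal) (χ : T × T → ℝ) : Prop where
  measurable : ∀ t, Measurable (X t)
  identical_margins : ∀ s t, IdentDistrib (X s) (X t) P P
  upper_endpoint : ∀ t, upperEndpoint P (X t) = b
  tendsto : ∀ s t, Tendsto (fun τ : ℝ => (P[|{ω | τ < X t ω}]).real {ω | τ < X s ω})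
    (thresholdsTo b) (𝓝 (χ (s, t)))

/-- The set of all tail correlation functions on `T × T`. It is no restriction that the
probability space lives in the universe of `T`, see `HasTCF.mem_TCF`. -/
def TCF (T : Type u) : Set (T × T → ℝ) :=
  {χ | ∃ (Ω : Type u) (_ : MeasurableSpace Ω) (P : Measure Ω) (X : T → Ω → ℝ) (b : EReal),
    IsProbabilityMeasure P ∧ HasTCF P X b χ}

/-- A tail correlation function of a process on a probability space in any universe lies in
`TCF T`: pass to the law of the process on the path space `T → ℝ`. -/
theorem HasTCF.mem_TCF {T : Type u} {Ω : Type v} [MeasurableSpace Ω] {P : Measure Ω}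
    [IsProbabilityMeasure P] {X : T → Ω → ℝ} {b : EReal} {χ : T × T → ℝ} (h : HasTCF P X b χ) :
    χ ∈ TCF T := by
  have hX : Measurable (fun ω t => X t ω) := measurable_pi_lambda _ h.measurable
  have hm : ∀ t, Measurable (fun x : T → ℝ => x t) := fun t => measurable_pi_apply t
  refine ⟨T → ℝ, inferInstance, P.map (fun ω t => X t ω), fun t x => x t, b,
    Measure.isProbabilityMeasure_map hX.aemeasurable, hm, fun s t => ⟨(hm s).aemeasurable,
      (hm t).aemeasurable, ?_⟩, fun t => ?_, fun s t => ?_⟩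
  · rw [Measure.map_map (hm s) hX, Measure.map_map (hm t) hX]
    exact (h.identical_margins s t).map_eq
  · rw [← h.upper_endpoint t]
    exact essSup_map_measure (measurable_coe_real_ereal.comp (hm t)).aemeasurable hX.aemeasurable
  · convert h.tendsto s t using 2 with τ
    have hs : ∀ r, MeasurableSet {x : T → ℝ | τ < x r} :=
      fun r => measurableSet_lt measurable_const (hm r)
    have hs' : ∀ r, MeasurableSet {ω | τ < X r ω} :=
      fun r => measurableSet_lt measurable_const (h.measurable r)
    simp only [Measure.real]
    rw [cond_apply (hs t), cond_apply (hs' t), Measure.map_apply hX (hs t),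
      Measure.map_apply hX ((hs t).inter (hs s))]
    rfl

/-! `TCF T` is the closure of `eventCorrelations T`, the functions `μ (A s ∩ A t)` with `μ` finite
and `μ (A t) = 1`. These form a convex subset of a cube `[0,1]^(T × T)`, so the closure is convex
and compact. A TCF lies in the closure because, at each fixed threshold, the conditional exceedance
probabilities are an event correlation. Conversely, a Poisson process with intensity `μ ⊗ Lebesgue`
on `[0,1]` has points `(x, u)`; let `t` reach level `n` if some point has `x t = true` and `u ≤ 1 /
(n + 1)`. Then `s` and `t` both miss level `n` with probability `exp (-μ (A s ∪ A t) / (n + 1))`,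
where `μ (A s ∪ A t) = 2 - χ (s, t)`. Such level systems survive pointwise limits of `χ` by
compactness of `{0,1}^(T × ℕ)`, and the first missed level is a process with upper endpoint `∞` and
TCF `χ`. Products come from minima of independent processes, for which conditional exceedance
probabilities multiply. -/

/-! ### Compactness of laws on `ι → Bool`. -/

/-- Along an ultrafilter, probability measures on `ι → Bool` converge on all cylinder sets to a
probability measure. -/
theorem exists_tendsto_measurableCylinders {ι κ : Type*} (U : Ultrafilter κ)
    (Q : κ → Measure (ι → Bool)) (hQ : ∀ k, IsProbabilityMeasure (Q k)) :
    ∃ R : Measure (ι → Bool), IsProbabilityMeasure R ∧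
      ∀ s ∈ measurableCylinders (fun _ : ι => Bool),
        Tendsto (fun k => Q k s) U (𝓝 (R s)) := by
  have hlim : ∀ s : Set (ι → Bool), ∃ r, Tendsto (fun k => Q k s) U (𝓝 r) := fun s =>
    ⟨_, (U.map fun k => Q k s).le_nhds_lim⟩
  choose m hm using hlim
  have hC : IsSetRing (measurableCylinders fun _ : ι => Bool) := isSetRing_measurableCylinders
  have hmeas : ∀ s ∈ measurableCylinders (fun _ : ι => Bool), MeasurableSet s :=
    fun s hs => MeasurableSet.of_mem_measurableCylinders hs
  have hclopen : ∀ s ∈ measurableCylinders (fun _ : ι => Bool), IsClopen s := by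
    intro s hs
    obtain ⟨I, S, -, rfl⟩ := (mem_measurableCylinders _).1 hs
    exact (isClopen_discrete S).preimage (by fun_prop)
  let M : AddContent ENNReal (measurableCylinders (fun _ : ι => Bool)) :=
    hC.addContent_of_union m
      (tendsto_nhds_unique (hm ∅) (by simp))
      (fun {s t} hs ht hst => tendsto_nhds_unique (hm _) <| by
        simpa only [measure_union hst (hmeas t ht)] using (hm s).add (hm t))
  have hM : ∀ s, M s = m s := fun _ => rfl
  -- Cylinders are clopen in a compact space, so a countable cover of one by others has a finite
  -- subcover and finite additivity suffices.
  have hsub : M.IsSigmaSubadditive := by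
    intro f hf hU
    obtain ⟨F, hF⟩ := (hclopen _ hU).isClosed.isCompact.elim_finite_subcover f
      (fun n => (hclopen _ (hf n)).isOpen) subset_rfl
    calc M (⋃ n, f n) = M (⋃ n ∈ F, f n) := by
          congr 1
          exact hF.antisymm (Set.iUnion₂_subset_iUnion _ _)
      _ ≤ ∑ n ∈ F, M (f n) := addContent_biUnion_le hC (fun n _ => hf n)
      _ ≤ ∑' n, M (f n) := ENNReal.sum_le_tsum F
  have hR : ∀ s ∈ measurableCylinders (fun _ : ι => Bool),
      M.measure hC.isSetSemiring generateFrom_measurableCylinders.ge hsub s = m s :=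
    fun s hs => M.measure_eq hC.isSetSemiring generateFrom_measurableCylinders.symm hsub hs
  refine ⟨M.measure hC.isSetSemiring generateFrom_measurableCylinders.ge hsub, ⟨?_⟩,
    fun s hs => hR s hs ▸ hm s⟩
  rw [hR _ (univ_mem_measurableCylinders _)]
  exact tendsto_nhds_unique (hm _) (by simp)

/-- Events which depend on two coordinates are cylinder sets. -/
theorem setOf_coord_mem_measurableCylinders {ι : Type*} (i j : ι) (p : Bool → Bool → Prop) :
    {x : ι → Bool | p (x i) (x j)} ∈ measurableCylinders (fun _ : ι => Bool) := by
  classical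
  refine (mem_measurableCylinders _).2 ⟨{i, j},
    {y | p (y ⟨i, by simp⟩) (y ⟨j, by simp⟩)}, ?_, rfl⟩
  exact Set.Finite.measurableSet (Set.toFinite _)

theorem measurableSet_setOf_coord {ι : Type*} (i j : ι) (p : Bool → Bool → Prop) :
    MeasurableSet {x : ι → Bool | p (x i) (x j)} :=
  .of_mem_measurableCylinders (setOf_coord_mem_measurableCylinders i j p)

/-- Along an ultrafilter, the two-dimensional margins of probability measures on `ι → Bool`
converge to those of a probability measure. -/
theorem exists_tendsto_setOf_coord {ι κ : Type*} (U : Ultrafilter κ)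
    (Q : κ → Measure (ι → Bool)) (hQ : ∀ k, IsProbabilityMeasure (Q k)) :
    ∃ R : Measure (ι → Bool), IsProbabilityMeasure R ∧
      ∀ i j (p : Bool → Bool → Prop),
        Tendsto (fun k => (Q k).real {x | p (x i) (x j)}) U (𝓝 (R.real {x | p (x i) (x j)})) := by
  obtain ⟨R, hR, h⟩ := exists_tendsto_measurableCylinders U Q hQ
  exact ⟨R, hR, fun i j p => (ENNReal.tendsto_toReal (measure_ne_top R _)).comp
    (h _ (setOf_coord_mem_measurableCylinders i j p))⟩

/-! ### Maxima of Poisson processes. -/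

/-- The coordinatewise maximum of `m` independent copies of a random element of `ι → Bool`. -/
theorem exists_measure_avoid_pow {ι : Type*} (ρ : Measure (ι → Bool)) [IsProbabilityMeasure ρ]
    (m : ℕ) : ∃ Q : Measure (ι → Bool), IsProbabilityMeasure Q ∧
      ∀ i j, Q.real {x | x i = false ∧ x j = false} =
        ρ.real {x | x i = false ∧ x j = false} ^ m := by
  classical
  let f : (Fin m → ι → Bool) → ι → Bool := fun ω i => decide (∃ k, ω k i = true)
  have hf : Measurable f := by
    refine measurable_pi_lambda _ fun i => measurable_to_bool ?_
    have : (fun ω => f ω i) ⁻¹' {true} = ⋃ k, {ω : Fin m → ι → Bool | ω k i = true} := by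
      ext ω; simp [f]
    rw [this]
    refine MeasurableSet.iUnion fun k => ?_
    have : Measurable fun ω : Fin m → ι → Bool => ω k i := by fun_prop
    exact this (measurableSet_singleton true)
  refine ⟨(Measure.pi fun _ : Fin m => ρ).map f, Measure.isProbabilityMeasure_map hf.aemeasurable,
    fun i j => ?_⟩
  rw [map_measureReal_apply hf
    (measurableSet_setOf_coord i j fun a b => a = false ∧ b = false)]
  have : f ⁻¹' {x | x i = false ∧ x j = false} =
      Set.univ.pi fun _ : Fin m => {x : ι → Bool | x i = false ∧ x j = false} := by
    ext ω; simp [f, forall_and]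
  simp [this, Measure.real, Measure.pi_pi]

/-- A finite measure `μ` on `ι → Bool`, as the intensity of a Poisson process, induces a random
element of `ι → Bool`, the coordinatewise maximum of the points of the process. -/
theorem exists_measure_avoid_exp {ι : Type*} (μ : Measure (ι → Bool)) [IsFiniteMeasure μ] :
    ∃ Q : Measure (ι → Bool), IsProbabilityMeasure Q ∧
      ∀ i j, Q.real {x | x i = false ∧ x j = false} =
        Real.exp (-μ.real {x | x i = true ∨ x j = true}) := by
  have key : ∀ m : ℕ, ∃ Q : Measure (ι → Bool), IsProbabilityMeasure Q ∧
      (μ.real Set.univ ≤ m → 0 < m → ∀ i j, Q.real {x | x i = false ∧ x j = false} =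
        (1 + -μ.real {x | x i = true ∨ x j = true} / m) ^ m) := by
    intro m
    by_cases hm : μ.real Set.univ ≤ m ∧ 0 < m
    swap
    · exact ⟨Measure.dirac fun _ => false, inferInstance, fun h h' => absurd ⟨h, h'⟩ hm⟩
    obtain ⟨hm, hm0⟩ := hm
    have hm1 : (0 : ℝ) < m := by exact_mod_cast hm0
    have hc : (0 : ℝ) ≤ 1 - μ.real Set.univ / m := by
      rw [sub_nonneg, div_le_one hm1]; exact hm
    -- Binomial approximation of the Poisson process: each of `m` trials draws a point with
    -- intensity `μ / m`, and the remaining mass sits at `false`, which does not affect the maximum.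
    let ρ : Measure (ι → Bool) := (1 / m : ℝ).toNNReal • μ +
      (1 - μ.real Set.univ / m).toNNReal • Measure.dirac fun _ => false
    have hρ : ∀ s, ρ.real s = 1 / m * μ.real s +
        (1 - μ.real Set.univ / m) * (Measure.dirac fun _ : ι => false).real s := by
      intro s
      rw [measureReal_add_apply, measureReal_nnreal_smul_apply, measureReal_nnreal_smul_apply,
        Real.coe_toNNReal _ hc, Real.coe_toNNReal _ (by positivity)]
    have : IsProbabilityMeasure ρ := by
      refine isProbabilityMeasure_iff_real.2 ?_
      rw [hρ]
      simp
      field_simp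
      ring
    obtain ⟨Q, hQ, h⟩ := exists_measure_avoid_pow ρ m
    refine ⟨Q, hQ, fun _ _ i j => ?_⟩
    have hcompl : {x : ι → Bool | x i = false ∧ x j = false} =
        {x | x i = true ∨ x j = true}ᶜ := by ext x; simp
    have hmeas := measurableSet_setOf_coord i j fun a b => a = true ∨ b = true
    rw [h, hρ, hcompl, measureReal_compl hmeas, measureReal_compl hmeas]
    simp [Measure.real, Measure.dirac_apply' _ hmeas]
    ring
  choose Q hQ h using key
  obtain ⟨R, hR, hlim⟩ := exists_tendsto_setOf_coord (hyperfilter ℕ) Q hQ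
  refine ⟨R, hR, fun i j => tendsto_nhds_unique (hlim i j fun a b => a = false ∧ b = false) ?_⟩
  have hexp := (Real.tendsto_one_add_div_pow_exp
    (-μ.real {x | x i = true ∨ x j = true})).mono_left Nat.hyperfilter_le_atTop
  refine hexp.congr' ?_
  have h1 : ∀ᶠ m : ℕ in atTop, μ.real Set.univ ≤ m :=
    tendsto_natCast_atTop_atTop.eventually_ge_atTop _
  filter_upwards [Nat.hyperfilter_le_atTop h1,
    Nat.hyperfilter_le_atTop (eventually_gt_atTop 0)] with m hm hm0
  exact (h m hm hm0 i j).symm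

/-! ### Event correlations and level correlations. -/

/-- The functions `(s, t) ↦ μ (A s ∩ A t)` for families of events `A t` with `μ (A t) = 1` in a
finite measure space. -/
def eventCorrelations (T : Type u) : Set (T × T → ℝ) :=
  {χ | ∃ μ : Measure (T → Bool), IsFiniteMeasure μ ∧ (∀ t, μ.real {x | x t = true} = 1) ∧
    ∀ s t, μ.real {x | x s = true ∧ x t = true} = χ (s, t)}

theorem convex_eventCorrelations (T : Type u) : Convex ℝ (eventCorrelations T) := by
  rintro χ ⟨μ, hμ, h1, h2⟩ χ' ⟨μ', hμ', h1', h2'⟩ a b ha hb hab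
  have h : ∀ s, (a.toNNReal • μ + b.toNNReal • μ').real s = a * μ.real s + b * μ'.real s := by
    intro s
    rw [measureReal_add_apply, measureReal_nnreal_smul_apply, measureReal_nnreal_smul_apply,
      Real.coe_toNNReal _ ha, Real.coe_toNNReal _ hb]
  exact ⟨a.toNNReal • μ + b.toNNReal • μ', inferInstance, fun t => by simp [h, h1, h1', hab],
    fun s t => by simp [h, h2, h2']⟩

theorem eventCorrelations_subset_Icc (T : Type u) :
    eventCorrelations T ⊆ Set.univ.pi fun _ => Set.Icc 0 1 := by
  rintro χ ⟨μ, hμ, h1, h2⟩ ⟨s, t⟩ -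
  rw [← h2]
  exact ⟨measureReal_nonneg, (measureReal_mono fun x hx => hx.1).trans_eq (h1 s)⟩

theorem isCompact_closure_eventCorrelations (T : Type u) :
    IsCompact (closure (eventCorrelations T)) :=
  (isCompact_univ_pi fun _ => isCompact_Icc).closure_of_subset (eventCorrelations_subset_Icc T)

/-- The functions `χ` for which there is a random family of nested levels `x (t, n)` such that
neither `s` nor `t` reaches level `n` with probability `exp (- (2 - χ (s, t)) / (n + 1))`. -/
def levelCorrelations (T : Type u) : Set (T × T → ℝ) :=
  {χ | ∃ Q : Measure (T × ℕ → Bool), IsProbabilityMeasure Q ∧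
    (∀ t n, Q.real {x | x (t, n) = false} = Real.exp (-(1 / (n + 1)))) ∧
    (∀ t n, Q.real {x | x (t, n) = false ∧ x (t, n + 1) = false} = Real.exp (-(1 / (n + 1)))) ∧
    ∀ s t n, Q.real {x | x (s, n) = false ∧ x (t, n) = false} =
      Real.exp (-((2 - χ (s, t)) * (1 / (n + 1))))}

theorem eventCorrelations_subset_levelCorrelations (T : Type u) :
    eventCorrelations T ⊆ levelCorrelations T := by
  rintro χ ⟨μ, hμ, h1, h2⟩
  let ν := μ.prod (volume.restrict (Set.Icc (0 : ℝ) 1))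
  let g : (T → Bool) × ℝ → T × ℕ → Bool := fun y p => y.1 p.1 && decide (y.2 ≤ 1 / (p.2 + 1))
  have hg : Measurable g := by
    refine measurable_pi_lambda _ fun p => measurable_to_bool ?_
    have : (fun y => g y p) ⁻¹' {true} =
        {x : T → Bool | x p.1 = true} ×ˢ {u : ℝ | u ≤ 1 / (p.2 + 1)} := by
      ext y; simp [g]
    rw [this]
    exact (measurableSet_setOf_coord p.1 p.1 fun a _ => a = true).prod measurableSet_Iic
  obtain ⟨Q, hQ, h⟩ := exists_measure_avoid_exp (ν.map g)
  -- Heights are uniform on `[0,1]`, so level `n` scales the intensity by `1 / (n + 1)`.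
  have hprod : ∀ (s : Set (T → Bool)) (n : ℕ),
      ν.real (s ×ˢ Set.Iic (1 / ((n : ℝ) + 1))) = μ.real s * (1 / (n + 1)) := by
    intro s n
    have hn : (0 : ℝ) ≤ 1 / (n + 1) := by positivity
    have hn' : (1 : ℝ) / (n + 1) ≤ 1 := by
      rw [div_le_one (by positivity)]; linarith [n.cast_nonneg (α := ℝ)]
    rw [measureReal_prod_prod, measureReal_restrict_apply measurableSet_Iic]
    have : Set.Iic (1 / ((n : ℝ) + 1)) ∩ Set.Icc 0 1 = Set.Icc 0 (1 / ((n : ℝ) + 1)) := by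
      ext u
      simp only [Set.mem_inter_iff, Set.mem_Iic, Set.mem_Icc]
      exact ⟨fun h => ⟨h.2.1, h.1⟩, fun h => ⟨h.2, h.1, h.2.trans hn'⟩⟩
    rw [this, Real.volume_real_Icc_of_le hn, sub_zero]
  have hmap : ∀ p q : T × ℕ, (ν.map g).real {x | x p = true ∨ x q = true} =
      ν.real {y | g y p = true ∨ g y q = true} := fun p q =>
    map_measureReal_apply hg (measurableSet_setOf_coord p q fun a b => a = true ∨ b = true)
  have hor : ∀ s t, μ.real {x | x s = true ∨ x t = true} = 2 - χ (s, t) := by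
    intro s t
    have := measureReal_union_add_inter (μ := μ) (s := {x | x s = true})
      (measurableSet_setOf_coord t t fun a _ => a = true)
    rw [h1, h1] at this
    rw [← h2]
    exact eq_sub_of_add_eq (this.trans one_add_one_eq_two)
  refine ⟨Q, hQ, fun t n => ?_, fun t n => ?_, fun s t n => ?_⟩
  · have := h (t, n) (t, n)
    simp only [and_self] at this
    rw [this, hmap]
    have : {y | g y (t, n) = true ∨ g y (t, n) = true} =
        {x : T → Bool | x t = true} ×ˢ Set.Iic (1 / ((n : ℝ) + 1)) := by ext y; simp [g]
    rw [this, hprod, h1, one_mul]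
  · rw [h, hmap]
    have : {y | g y (t, n) = true ∨ g y (t, n + 1) = true} =
        {x : T → Bool | x t = true} ×ˢ Set.Iic (1 / ((n : ℝ) + 1)) := by
      ext y
      have : (1 : ℝ) / ((n + 1 : ℕ) + 1) ≤ 1 / (n + 1) :=
        one_div_le_one_div_of_le (by positivity) (by push_cast; linarith)
      simp only [g, Bool.and_eq_true, decide_eq_true_eq, Set.mem_ofPred_eq, Set.mem_prod,
        Set.mem_Iic]
      exact ⟨fun h => h.elim id fun h => ⟨h.1, h.2.trans this⟩, Or.inl⟩
    rw [this, hprod, h1, one_mul]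
  · rw [h, hmap]
    have : {y | g y (s, n) = true ∨ g y (t, n) = true} =
        {x : T → Bool | x s = true ∨ x t = true} ×ˢ Set.Iic (1 / ((n : ℝ) + 1)) := by
      ext y; simp [g, or_and_right]
    rw [this, hprod, hor]

/-- Every defining condition, nestedness of the levels included, is an equation for a probability
involving two coordinates, with right side continuous in `χ`. It therefore passes to ultrafilter
limits of the laws. -/
theorem isClosed_levelCorrelations (T : Type u) : IsClosed (levelCorrelations T) := by
  refine isClosed_iff_ultrafilter.2 fun χ U hU hmem => ?_
  have key : ∀ ψ : T × T → ℝ, ∃ Q : Measure (T × ℕ → Bool), IsProbabilityMeasure Q ∧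
      (ψ ∈ levelCorrelations T →
        (∀ t n, Q.real {x | x (t, n) = false} = Real.exp (-(1 / (n + 1)))) ∧
        (∀ t n, Q.real {x | x (t, n) = false ∧ x (t, n + 1) = false} =
          Real.exp (-(1 / (n + 1)))) ∧
        ∀ s t n, Q.real {x | x (s, n) = false ∧ x (t, n) = false} =
          Real.exp (-((2 - ψ (s, t)) * (1 / (n + 1))))) := by
    intro ψ
    by_cases hψ : ψ ∈ levelCorrelations T
    · obtain ⟨Q, hQ, h⟩ := hψ
      exact ⟨Q, hQ, fun _ => h⟩
    · exact ⟨Measure.dirac fun _ => false, inferInstance, fun h => absurd h hψ⟩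
  choose Q hQ h using key
  obtain ⟨R, hR, hlim⟩ := exists_tendsto_setOf_coord U Q hQ
  refine ⟨R, hR, fun t n => ?_, fun t n => ?_, fun s t n => ?_⟩
  · refine tendsto_nhds_unique (hlim (t, n) (t, n) fun a _ => a = false)
      (tendsto_const_nhds.congr' ?_)
    filter_upwards [hmem] with ψ hψ using ((h ψ hψ).1 t n).symm
  · refine tendsto_nhds_unique (hlim (t, n) (t, n + 1) fun a b => a = false ∧ b = false)
      (tendsto_const_nhds.congr' ?_)
    filter_upwards [hmem] with ψ hψ using ((h ψ hψ).2.1 t n).symm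
  · have hψ : Tendsto (fun ψ : T × T → ℝ => Real.exp (-((2 - ψ (s, t)) * (1 / ((n : ℝ) + 1)))))
        U (𝓝 (Real.exp (-((2 - χ (s, t)) * (1 / (n + 1)))))) :=
      ((by fun_prop : Continuous fun ψ : T × T → ℝ =>
        Real.exp (-((2 - ψ (s, t)) * (1 / ((n : ℝ) + 1))))).tendsto χ).mono_left hU
    refine tendsto_nhds_unique (hlim (s, n) (t, n) fun a b => a = false ∧ b = false)
      (hψ.congr' ?_)
    filter_upwards [hmem] with ψ hψ using ((h ψ hψ).2.2 s t n).symm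

/-! ### Upper endpoints and thresholds. -/

theorem thresholdsTo_top : thresholdsTo ⊤ = atTop := by
  have h : (𝓝[<] (⊤ : EReal)) = map ((↑) : ℝ → EReal) atTop := by
    rw [← EReal.nhdsWithin_top]
    congr 1
    ext x
    simp [lt_top_iff_ne_top]
  rw [thresholdsTo, h, comap_map EReal.coe_injective]

theorem upperEndpoint_eq_top_iff {Ω : Type v} [MeasurableSpace Ω] {P : Measure Ω} {Y : Ω → ℝ} :
    upperEndpoint P Y = ⊤ ↔ ∀ τ : ℝ, P {ω | τ < Y ω} ≠ 0 := by
  constructor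
  · intro h τ h0
    have : upperEndpoint P Y ≤ τ := by
      refine essSup_le_of_ae_le _ ?_
      filter_upwards [measure_eq_zero_iff_ae_notMem.1 h0] with ω hω
      exact EReal.coe_le_coe_iff.2 (not_lt.1 hω)
    rw [h, top_le_iff] at this
    exact EReal.coe_ne_top τ this
  · intro h
    refine EReal.eq_top_iff_forall_lt _ |>.2 fun τ => lt_of_not_ge fun hle => h τ ?_
    refine measure_eq_zero_iff_ae_notMem.2 ?_
    filter_upwards [ae_le_essSup (f := fun ω => (Y ω : EReal)) (μ := P)] with ω hω
    exact not_lt.2 (EReal.coe_le_coe_iff.1 (hω.trans hle))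

/-- Below the upper endpoint, exceedances have positive probability. -/
theorem measure_lt_ne_zero_of_lt_upperEndpoint {Ω : Type v} [MeasurableSpace Ω] {P : Measure Ω}
    {Y : Ω → ℝ} {τ : ℝ} (h : (τ : EReal) < upperEndpoint P Y) : P {ω | τ < Y ω} ≠ 0 := by
  intro h0
  refine h.not_ge (essSup_le_of_ae_le _ ?_)
  filter_upwards [measure_eq_zero_iff_ae_notMem.1 h0] with ω hω
  exact EReal.coe_le_coe_iff.2 (not_lt.1 hω)

theorem upperEndpoint_ne_bot {Ω : Type v} [MeasurableSpace Ω] {P : Measure Ω} [NeZero P]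
    {Y : Ω → ℝ} : upperEndpoint P Y ≠ ⊥ := by
  intro h
  have : ∀ᵐ ω ∂P, False := by
    filter_upwards [ae_le_essSup (f := fun ω => (Y ω : EReal)) (μ := P)] with ω hω
    exact EReal.coe_ne_bot (Y ω) (le_bot_iff.1 (hω.trans_eq h))
  exact NeZero.ne P (ae_eq_bot.1 (eventually_false_iff_eq_bot.1 this))

theorem thresholdsTo_neBot {b : EReal} (hb : b ≠ ⊥) : (thresholdsTo b).NeBot := by
  refine comap_neBot fun s hs => ?_
  obtain ⟨l, hl, hs⟩ := (mem_nhdsLT_iff_exists_Ioo_subset' (bot_lt_iff_ne_bot.2 hb)).1 hs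
  obtain ⟨r, h1, h2⟩ := EReal.lt_iff_exists_real_btwn.1 hl
  exact ⟨r, hs ⟨h1, h2⟩⟩

theorem eventually_thresholdsTo_lt (b : EReal) : ∀ᶠ τ : ℝ in thresholdsTo b, (τ : EReal) < b :=
  tendsto_comap.eventually self_mem_nhdsWithin

theorem condReal_apply {Ω : Type v} [MeasurableSpace Ω] (P : Measure Ω) {A : Set Ω}
    (hA : MeasurableSet A) (B : Set Ω) : (P[|A]).real B = (P.real A)⁻¹ * P.real (A ∩ B) := by
  simp [Measure.real, cond_apply hA]

/-! ### Tail correlation functions as limits of event correlations. -/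

theorem TCF_subset_closure_eventCorrelations (T : Type u) :
    TCF T ⊆ closure (eventCorrelations T) := by
  rintro χ ⟨Ω, _, P, X, b, hP, h⟩
  rcases isEmpty_or_nonempty T with hT | ⟨⟨t₀⟩⟩
  -- With no index, `b` is unconstrained and may be `⊥`, so this case is separate.
  · exact subset_closure ⟨0, inferInstance, isEmptyElim, isEmptyElim⟩
  have hb : b ≠ ⊥ := h.upper_endpoint t₀ ▸ upperEndpoint_ne_bot
  have := thresholdsTo_neBot hb
  refine mem_closure_of_tendsto
    (tendsto_pi_nhds.2 fun p : T × T => h.tendsto p.1 p.2) ?_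
  filter_upwards [eventually_thresholdsTo_lt b] with τ hτ
  have hA : ∀ t, MeasurableSet {ω | τ < X t ω} := fun t =>
    measurableSet_lt measurable_const (h.measurable t)
  have hq : ∀ t, P.real {ω | τ < X t ω} = P.real {ω | τ < X t₀ ω} := fun t =>
    congrArg ENNReal.toReal ((h.identical_margins t t₀).measure_mem_eq measurableSet_Ioi)
  have hpos : 0 < P.real {ω | τ < X t₀ ω} := measureReal_nonneg.lt_of_ne' <|
    (measureReal_ne_zero_iff (measure_ne_top _ _)).2
      (measure_lt_ne_zero_of_lt_upperEndpoint (by rwa [h.upper_endpoint]))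
  set q := P.real {ω | τ < X t₀ ω}
  let f : Ω → T → Bool := fun ω t => decide (τ < X t ω)
  have hf : Measurable f := by
    refine measurable_pi_lambda _ fun t => measurable_to_bool ?_
    have : (fun ω => f ω t) ⁻¹' {true} = {ω | τ < X t ω} := by ext; simp [f]
    rw [this]
    exact hA t
  have hreal : ∀ s, MeasurableSet s →
      (q⁻¹.toNNReal • P.map f).real s = q⁻¹ * P.real (f ⁻¹' s) := by
    intro s hs
    rw [measureReal_nnreal_smul_apply, map_measureReal_apply hf hs,
      Real.coe_toNNReal _ (by positivity)]
  -- The law of the exceedance indicators, divided by the common exceedance probability `q`.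
  refine ⟨q⁻¹.toNNReal • P.map f, inferInstance, fun t => ?_, fun s t => ?_⟩
  · rw [hreal _ (measurableSet_setOf_coord t t fun a _ => a = true)]
    have : f ⁻¹' {x | x t = true} = {ω | τ < X t ω} := by ext; simp [f]
    rw [this, hq, inv_mul_cancel₀ hpos.ne']
  · rw [hreal _ (measurableSet_setOf_coord s t fun a b => a = true ∧ b = true)]
    dsimp only
    rw [condReal_apply P (hA t), hq]
    congr 2
    ext; simp [f, and_comm]

/-! ### Realizing level correlations with upper endpoint `∞`. -/

theorem exists_eq_false_or_forall_eq_true (y : ℕ → Bool) : ∃ n, y n = false ∨ ∀ m, y m = true := by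
  by_cases h : ∃ n, y n = false
  · exact h.imp fun _ => Or.inl
  · exact ⟨0, Or.inr fun m => by simpa using mt (Exists.intro m) h⟩

/-- The first index at which a Boolean sequence is `false`, or `0` if there is none. -/
noncomputable def firstFalse (y : ℕ → Bool) : ℕ := by
  classical exact Nat.find (exists_eq_false_or_forall_eq_true y)

theorem measurable_firstFalse : Measurable firstFalse := by
  classical
  refine measurable_find exists_eq_false_or_forall_eq_true fun n => ?_
  have h : ∀ m (b : Bool), MeasurableSet {y : ℕ → Bool | y m = b} := fun m b =>
    measurableSet_setOf_coord m m fun a _ => a = b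
  have h_all : MeasurableSet {y : ℕ → Bool | ∀ m, y m = true} := by
    simpa only [Set.ofPred_forall] using MeasurableSet.iInter fun m => h m true
  exact (h n false).union h_all

theorem firstFalse_le_iff {y : ℕ → Bool} (hy : ∃ n, y n = false)
    (hmono : ∀ n, y n = false → y (n + 1) = false) (n : ℕ) :
    firstFalse y ≤ n ↔ y n = false := by
  classical
  have hnot : ¬∀ m, y m = true := fun h => by
    obtain ⟨n, hn⟩ := hy
    simp [h] at hn
  have : firstFalse y ≤ n ↔ ∃ m ≤ n, y m = false := by
    simp only [firstFalse, Nat.find_le_iff, hnot, or_false]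
  rw [this]
  exact ⟨fun ⟨m, hmn, hm⟩ => Nat.le_induction hm (fun k _ hk => hmono k hk) n hmn,
    fun h => ⟨n, le_rfl, h⟩⟩

theorem tendsto_one_sub_exp_neg_mul_div (c : ℝ) :
    Tendsto (fun n : ℕ => (1 - Real.exp (-(c * (1 / ((n : ℝ) + 1))))) / (1 / ((n : ℝ) + 1)))
      atTop (𝓝 c) := by
  have hd : HasDerivAt (fun x : ℝ => 1 - Real.exp (-(c * x))) c 0 := by
    have h := (((hasDerivAt_id (0 : ℝ)).const_mul c).neg.exp).const_sub 1
    simpa using h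
  have h0 : Tendsto (fun n : ℕ => 1 / ((n : ℝ) + 1)) atTop (𝓝[≠] 0) :=
    tendsto_nhdsWithin_iff.2 ⟨tendsto_one_div_add_atTop_nhds_zero_nat,
      Eventually.of_forall fun n => by simp; positivity⟩
  refine ((hasDerivAt_iff_tendsto_slope_zero.1 hd).comp h0).congr fun n => ?_
  simp [div_eq_inv_mul]

/-- Inclusion-exclusion writes the joint exceedance probability as the second factor; to first order
in `1 / (n + 1)` the ratio is `2 - (2 - c)`. -/
theorem tendsto_exp_ratio (c : ℝ) :
    Tendsto (fun n : ℕ => (1 - Real.exp (-(1 / ((n : ℝ) + 1))))⁻¹ *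
      (2 * (1 - Real.exp (-(1 / ((n : ℝ) + 1)))) -
        (1 - Real.exp (-((2 - c) * (1 / ((n : ℝ) + 1)))))))
      atTop (𝓝 c) := by
  have h1 := tendsto_one_sub_exp_neg_mul_div 1
  have h2 := tendsto_one_sub_exp_neg_mul_div (2 - c)
  have h := (h2.div h1 one_ne_zero).const_sub 2
  simp only [one_mul, div_one, sub_sub_cancel] at h
  refine h.congr fun n => ?_
  have hn : (0 : ℝ) < 1 / (n + 1) := by positivity
  have hpos : 1 - Real.exp (-(1 / ((n : ℝ) + 1))) ≠ 0 :=
    (sub_pos.2 (Real.exp_lt_one_iff.2 (neg_lt_zero.2 hn))).ne'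
  simp only [Pi.div_apply]
  rw [div_div_div_cancel_right₀ hn.ne', mul_sub, mul_comm (2 : ℝ), inv_mul_cancel_left₀ hpos,
    div_eq_inv_mul]

/-- Every level correlation is the tail correlation function of a process with upper endpoint
`∞`. -/
theorem exists_hasTCF_top_of_mem_levelCorrelations {T : Type u} {χ : T × T → ℝ}
    (hχ : χ ∈ levelCorrelations T) :
    ∃ (Ω : Type u) (_ : MeasurableSpace Ω) (P : Measure Ω) (X : T → Ω → ℝ),
      IsProbabilityMeasure P ∧ HasTCF P X ⊤ χ := by
  obtain ⟨Q, hQ, h1, h2, h3⟩ := hχ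
  let N : T → (T × ℕ → Bool) → ℕ := fun t x => firstFalse fun n => x (t, n)
  have hN : ∀ t, Measurable (N t) := fun t =>
    measurable_firstFalse.comp (measurable_pi_lambda _ fun n => measurable_pi_apply (t, n))
  have hmeas : ∀ p q (r : Bool → Bool → Prop), MeasurableSet {x : T × ℕ → Bool | r (x p) (x q)} :=
    measurableSet_setOf_coord
  -- The events of missing level `n` and of missing both `n` and `n + 1` have equal probability, so
  -- their difference is null.
  have hmono : ∀ t, ∀ᵐ x ∂Q, ∀ n, x (t, n) = false → x (t, n + 1) = false := by
    refine fun t => ae_all_iff.2 fun n => ?_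
    have hsub : {x : T × ℕ → Bool | x (t, n) = false ∧ x (t, n + 1) = false} ⊆
        {x | x (t, n) = false} := fun x hx => hx.1
    have h := measureReal_sdiff (μ := Q) hsub
      (hmeas (t, n) (t, n + 1) fun a b => a = false ∧ b = false)
    rw [h1, h2, sub_self, measureReal_eq_zero_iff] at h
    filter_upwards [measure_eq_zero_iff_ae_notMem.1 h] with x hx hxn
    by_contra hxn'
    exact hx ⟨hxn, fun h => hxn' h.2⟩
  have hex : ∀ t, ∀ᵐ x ∂Q, ∃ n, x (t, n) = false := by
    intro t
    have hle : ∀ n : ℕ, Q.real {x | ¬∃ n, x (t, n) = false} ≤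
        1 - Real.exp (-(1 / ((n : ℝ) + 1))) := by
      intro n
      rw [← h1 t n, ← probReal_compl_eq_one_sub (hmeas (t, n) (t, n) fun a _ => a = false)]
      exact measureReal_mono fun x hx hxn => hx ⟨n, hxn⟩
    have hlim : Tendsto (fun n : ℕ => 1 - Real.exp (-(1 / ((n : ℝ) + 1)))) atTop (𝓝 0) := by
      have := ((Real.continuous_exp.tendsto _).comp
        (tendsto_one_div_add_atTop_nhds_zero_nat (𝕜 := ℝ)).neg).const_sub 1
      simpa using this
    exact (measureReal_eq_zero_iff).1 (le_antisymm (ge_of_tendsto' hlim hle) measureReal_nonneg)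
  have hiff : ∀ t, ∀ᵐ x ∂Q, ∀ n, N t x ≤ n ↔ x (t, n) = false := fun t => by
    filter_upwards [hmono t, hex t] with x hx hx' n using firstFalse_le_iff hx' hx n
  have hcdf : ∀ t (n : ℕ), Q.real {x | N t x ≤ n} = Real.exp (-(1 / (n + 1))) := by
    intro t n
    rw [← h1 t n]
    refine measureReal_congr ?_
    filter_upwards [hiff t] with x hx using propext (hx n)
  have hcdf₂ : ∀ s t (n : ℕ), Q.real {x | N s x ≤ n ∧ N t x ≤ n} =
      Real.exp (-((2 - χ (s, t)) * (1 / (n + 1)))) := by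
    intro s t n
    rw [← h3 s t n]
    refine measureReal_congr ?_
    filter_upwards [hiff s, hiff t] with x hx hx' using propext (and_congr (hx n) (hx' n))
  have hNle : ∀ t n, MeasurableSet {x | N t x ≤ n} := fun t n => hN t measurableSet_Iic
  have hgt : ∀ t (n : ℕ), Q.real {x | n < N t x} = 1 - Real.exp (-(1 / (n + 1))) := by
    intro t n
    rw [← hcdf t n, ← probReal_compl_eq_one_sub (hNle t n)]
    congr 1
    ext x; simp
  have hgt₂ : ∀ s t (n : ℕ), Q.real ({x | n < N t x} ∩ {x | n < N s x}) =
      2 * (1 - Real.exp (-(1 / (n + 1)))) -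
        (1 - Real.exp (-((2 - χ (s, t)) * (1 / (n + 1))))) := by
    intro s t n
    have h := measureReal_union_add_inter (μ := Q) (s := {x | n < N t x})
      (t := {x | n < N s x}) (hN s measurableSet_Ioi)
    have hu : {x | n < N t x} ∪ {x | n < N s x} = {x | N s x ≤ n ∧ N t x ≤ n}ᶜ := by
      ext x
      simp only [Set.mem_union, Set.mem_ofPred_eq, Set.mem_compl_iff, not_and_or, not_le]
      exact or_comm
    have hm : MeasurableSet {x | N s x ≤ n ∧ N t x ≤ n} := (hNle s n).inter (hNle t n)
    rw [hu, probReal_compl_eq_one_sub hm, hcdf₂, hgt, hgt] at h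
    linarith
  -- `N t` is integer-valued, so a real threshold acts through its floor.
  have hset : ∀ t (τ : ℝ), 0 ≤ τ → {x | τ < (N t x : ℝ)} = {x | ⌊τ⌋₊ < N t x} := by
    intro t τ hτ
    ext x
    exact (Nat.floor_lt hτ).symm
  refine ⟨T × ℕ → Bool, inferInstance, Q, fun t x => N t x, hQ, fun t => ?_, fun s t => ?_,
    fun t => ?_, fun s t => ?_⟩
  · exact measurable_from_top.comp (hN t)
  · refine IdentDistrib.comp (u := fun n : ℕ => (n : ℝ))
      ⟨(hN s).aemeasurable, (hN t).aemeasurable, ?_⟩ measurable_from_top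
    have := Measure.isProbabilityMeasure_map (μ := Q) (hN s).aemeasurable
    refine Measure.ext_of_Iic _ _ fun n => ?_
    rw [Measure.map_apply (hN s) measurableSet_Iic, Measure.map_apply (hN t) measurableSet_Iic,
      ← measureReal_eq_measureReal_iff]
    exact (hcdf s n).trans (hcdf t n).symm
  · refine upperEndpoint_eq_top_iff.2 fun τ h0 => ?_
    have hle : {x | ⌊max τ 0⌋₊ < N t x} ⊆ {x | τ < (N t x : ℝ)} := by
      rw [← hset t _ (le_max_right _ _)]
      exact fun x hx => (le_max_left τ 0).trans_lt hx
    have h := (measureReal_eq_zero_iff).2 (measure_mono_null hle h0)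
    rw [hgt, sub_eq_zero, eq_comm, Real.exp_eq_one_iff] at h
    have : (0 : ℝ) < 1 / ((⌊max τ 0⌋₊ : ℝ) + 1) := by positivity
    linarith
  · rw [thresholdsTo_top]
    refine ((tendsto_exp_ratio (χ (s, t))).comp
      (tendsto_nat_floor_atTop (α := ℝ))).congr' ?_
    filter_upwards [eventually_ge_atTop 0] with τ hτ
    rw [hset t τ hτ, hset s τ hτ, condReal_apply Q (A := {x | ⌊τ⌋₊ < N t x}) (hN t measurableSet_Ioi),
      hgt, hgt₂]
    rfl

theorem exists_hasTCF_top {T : Type u} {χ : T × T → ℝ} (hχ : χ ∈ TCF T) :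
    ∃ (Ω : Type u) (_ : MeasurableSpace Ω) (P : Measure Ω) (X : T → Ω → ℝ),
      IsProbabilityMeasure P ∧ HasTCF P X ⊤ χ :=
  exists_hasTCF_top_of_mem_levelCorrelations <|
    closure_minimal (eventCorrelations_subset_levelCorrelations T) (isClosed_levelCorrelations T)
      (TCF_subset_closure_eventCorrelations T hχ)

theorem TCF_eq_closure_eventCorrelations (T : Type u) :
    TCF T = closure (eventCorrelations T) := by
  refine (TCF_subset_closure_eventCorrelations T).antisymm fun χ hχ => ?_
  obtain ⟨Ω, _, P, X, _, h⟩ := exists_hasTCF_top_of_mem_levelCorrelations <|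
    closure_minimal (eventCorrelations_subset_levelCorrelations T) (isClosed_levelCorrelations T) hχ
  exact h.mem_TCF

/-! ### Products through independent minima. -/

theorem HasTCF.comp_measurePreserving {T : Type u} {Ω Ω' : Type*} [MeasurableSpace Ω]
    [MeasurableSpace Ω'] {P : Measure Ω} {P' : Measure Ω'} {X : T → Ω → ℝ} {b : EReal}
    {χ : T × T → ℝ} (h : HasTCF P X b χ) {f : Ω' → Ω} (hf : MeasurePreserving f P' P) :
    HasTCF P' (fun t ω => X t (f ω)) b χ where
  measurable t := (h.measurable t).comp hf.measurable
  identical_margins s t := by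
    refine ⟨((h.measurable s).comp hf.measurable).aemeasurable,
      ((h.measurable t).comp hf.measurable).aemeasurable, ?_⟩
    have := (h.identical_margins s t).map_eq
    rwa [← hf.map_eq, Measure.map_map (h.measurable s) hf.measurable,
      Measure.map_map (h.measurable t) hf.measurable] at this
  upper_endpoint t := by
    rw [← h.upper_endpoint t, upperEndpoint, upperEndpoint, ← hf.map_eq]
    exact (essSup_map_measure (measurable_coe_real_ereal.comp (h.measurable t)).aemeasurable
      hf.measurable.aemeasurable).symm
  tendsto s t := by
    refine (h.tendsto s t).congr fun τ => ?_
    have hA : ∀ t, MeasurableSet {ω | τ < X t ω} := fun t =>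
      measurableSet_lt measurable_const (h.measurable t)
    rw [condReal_apply P (hA t), condReal_apply P' (A := {ω | τ < X t (f ω)}) (hf.measurable (hA t)),
      ← hf.measureReal_preimage (hA t).nullMeasurableSet,
      ← hf.measureReal_preimage ((hA t).inter (hA s)).nullMeasurableSet]
    rfl

/-- The minimum exceeds `τ` exactly when both processes do, so independence factors numerator and
denominator. The shared endpoint `∞` lets both limits run along the same thresholds. -/
theorem HasTCF.min {T : Type u} {Ω : Type v} [MeasurableSpace Ω] {P : Measure Ω}
    [IsProbabilityMeasure P] {X₁ X₂ : T → Ω → ℝ} {χ₁ χ₂ : T × T → ℝ} (h₁ : HasTCF P X₁ ⊤ χ₁)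
    (h₂ : HasTCF P X₂ ⊤ χ₂) (hind : IndepFun (fun ω t => X₁ t ω) (fun ω t => X₂ t ω) P) :
    HasTCF P (fun t ω => min (X₁ t ω) (X₂ t ω)) ⊤ (χ₁ * χ₂) := by
  have hset : ∀ t (τ : ℝ), {ω | τ < Min.min (X₁ t ω) (X₂ t ω)} =
      {ω | τ < X₁ t ω} ∩ {ω | τ < X₂ t ω} := fun t τ => by ext; simp
  have hT : ∀ t (τ : ℝ), MeasurableSet {x : T → ℝ | τ < x t} := fun t τ =>
    measurableSet_lt measurable_const (measurable_pi_apply t)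
  have hA₁ : ∀ t (τ : ℝ), MeasurableSet {ω | τ < X₁ t ω} := fun t τ =>
    measurableSet_lt measurable_const (h₁.measurable t)
  have hA₂ : ∀ t (τ : ℝ), MeasurableSet {ω | τ < X₂ t ω} := fun t τ =>
    measurableSet_lt measurable_const (h₂.measurable t)
  have hmul : ∀ t τ, P ({ω | τ < X₁ t ω} ∩ {ω | τ < X₂ t ω}) =
      P {ω | τ < X₁ t ω} * P {ω | τ < X₂ t ω} := fun t τ =>
    hind.measure_inter_preimage_eq_mul _ _ (hT t τ) (hT t τ)
  have hmul₂ : ∀ s t τ, P (({ω | τ < X₁ t ω} ∩ {ω | τ < X₁ s ω}) ∩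
      ({ω | τ < X₂ t ω} ∩ {ω | τ < X₂ s ω})) =
      P ({ω | τ < X₁ t ω} ∩ {ω | τ < X₁ s ω}) * P ({ω | τ < X₂ t ω} ∩ {ω | τ < X₂ s ω}) :=
    fun s t τ => hind.measure_inter_preimage_eq_mul _ _ ((hT t τ).inter (hT s τ))
      ((hT t τ).inter (hT s τ))
  refine ⟨fun t => (h₁.measurable t).min (h₂.measurable t), fun s t => ?_, fun t => ?_,
    fun s t => ?_⟩
  · have hind' : ∀ t, IndepFun (X₁ t) (X₂ t) P := fun t =>
      hind.comp (measurable_pi_apply t) (measurable_pi_apply t)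
    have hpair := (h₁.identical_margins s t).prodMk (h₂.identical_margins s t) (hind' s) (hind' t)
    exact hpair.comp (u := fun p : ℝ × ℝ => Min.min p.1 p.2) (measurable_fst.min measurable_snd)
  · refine upperEndpoint_eq_top_iff.2 fun τ => ?_
    rw [hset, hmul]
    exact mul_ne_zero (upperEndpoint_eq_top_iff.1 (h₁.upper_endpoint t) τ)
      (upperEndpoint_eq_top_iff.1 (h₂.upper_endpoint t) τ)
  · refine ((h₁.tendsto s t).mul (h₂.tendsto s t)).congr fun τ => ?_
    rw [hset, hset, condReal_apply P (hA₁ t τ), condReal_apply P (hA₂ t τ),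
      condReal_apply P ((hA₁ t τ).inter (hA₂ t τ)), Set.inter_inter_inter_comm]
    simp only [Measure.real, hmul, hmul₂, ENNReal.toReal_mul]
    ring

theorem exists_indepFun_hasTCF_top {T : Type u} {χ₁ χ₂ : T × T → ℝ} (h₁ : χ₁ ∈ TCF T)
    (h₂ : χ₂ ∈ TCF T) :
    ∃ (Ω : Type u) (_ : MeasurableSpace Ω) (P : Measure Ω) (X₁ X₂ : T → Ω → ℝ),
      IsProbabilityMeasure P ∧ HasTCF P X₁ ⊤ χ₁ ∧ HasTCF P X₂ ⊤ χ₂ ∧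
      IndepFun (fun ω t => X₁ t ω) (fun ω t => X₂ t ω) P := by
  obtain ⟨Ω₁, _, P₁, X₁, _, h₁⟩ := exists_hasTCF_top h₁
  obtain ⟨Ω₂, _, P₂, X₂, _, h₂⟩ := exists_hasTCF_top h₂
  refine ⟨Ω₁ × Ω₂, inferInstance, P₁.prod P₂, fun t ω => X₁ t ω.1, fun t ω => X₂ t ω.2,
    inferInstance, h₁.comp_measurePreserving measurePreserving_fst,
    h₂.comp_measurePreserving measurePreserving_snd, ?_⟩
  exact indepFun_prod (measurable_pi_lambda _ h₁.measurable) (measurable_pi_lambda _ h₂.measurable)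

theorem mainTheorem2 (T : Type u) :
    Convex ℝ (TCF T) ∧
    (∀ χ₁ ∈ TCF T, ∀ χ₂ ∈ TCF T, χ₁ * χ₂ ∈ TCF T) ∧
    -- any two TCFs are realized by independent processes with upper endpoint `∞`
    (∀ χ₁ ∈ TCF T, ∀ χ₂ ∈ TCF T,
      ∃ (Ω : Type u) (_ : MeasurableSpace Ω) (P : Measure Ω) (X₁ X₂ : T → Ω → ℝ),
        IsProbabilityMeasure P ∧ HasTCF P X₁ ⊤ χ₁ ∧ HasTCF P X₂ ⊤ χ₂ ∧
        IndepFun (fun ω t => X₁ t ω) (fun ω t => X₂ t ω) P) ∧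
    -- the minimum of any such processes realizes the product
    (∀ (Ω : Type v) [MeasurableSpace Ω] (P : Measure Ω) [IsProbabilityMeasure P]
      (X₁ X₂ : T → Ω → ℝ) (χ₁ χ₂ : T × T → ℝ),
      HasTCF P X₁ ⊤ χ₁ → HasTCF P X₂ ⊤ χ₂ →
      IndepFun (fun ω t => X₁ t ω) (fun ω t => X₂ t ω) P →
      HasTCF P (fun t ω => min (X₁ t ω) (X₂ t ω)) ⊤ (χ₁ * χ₂)) ∧
    IsCompact (TCF T) := by

  have hmul : ∀ χ₁ ∈ TCF T, ∀ χ₂ ∈ TCF T, χ₁ * χ₂ ∈ TCF T := by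
    intro χ₁ h₁ χ₂ h₂
    obtain ⟨Ω, _, P, X₁, X₂, _, h₁, h₂, hind⟩ := exists_indepFun_hasTCF_top h₁ h₂
    exact (h₁.min h₂ hind).mem_TCF
  refine ⟨?_, hmul, fun χ₁ h₁ χ₂ h₂ => exists_indepFun_hasTCF_top h₁ h₂,
    fun Ω _ P _ X₁ X₂ χ₁ χ₂ h₁ h₂ hind => h₁.min h₂ hind, ?_⟩
  · rw [TCF_eq_closure_eventCorrelations]
    exact (convex_eventCorrelations T).closure
  · rw [TCF_eq_closure_eventCorrelations]
    exact isCompact_closure_eventCorrelations T
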